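/- Let $X$ be a real Banach space with an unconditional basis $(e_i)_{i\in I}$ ($I$ an arbitrary index set), with coordinate functionals $e_i^*$, and for $\sigma\subseteq I$ let $P_\sigma x=\sum_{i\in\sigma}e_i^*(x)e_i$. Assume that the basis is monotone, that is, $\|P_\sigma x\|\le\|x\|$ for all $\sigma\subseteq I$ and $x\in X$. Suppose that the unit sphere $S_X$ can be written as $S_X=\bigcup_{n=1}^\infty S_n$ in such a way that the numbers $$c_n=\inf\bigl\{\sup\{\|P_\sigma x\| : \sigma\subseteq I,\ |\sigma|=n\} : x\in S_n\bigr\},\qquad n\ge 1,$$ are strictly positive and converge to $1$. Then $X$ admits an equivalent $C^\infty$ smooth norm, that is, there are a norm $|||\cdot|||$ on $X$ and constants $a,b>0$ with $a\|x\|\le|||x|||\le b\|x\|$ for all $x\in X$, such that $|||\cdot|||$ has continuous Fréchet derivatives of all orders on $X\setminus\{0\}$. -/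

import Mathlib

open Filter Topology
open scoped ENNReal ContDiff

/-- An unconditional basis `(e i)` is monotone if the associated projections
`P_σ x = ∑ i ∈ σ, e i ^* (x) • e i` have norm at most one. It is enough to ask this for finite `σ`:
since `∑ i, e i ^* (x) • e i` converges unconditionally to `x`, the bound passes to arbitrary
`σ` by taking limits. -/
def IsMonotoneBasis {X ι : Type*} [NormedAddCommGroup X] [NormedSpace ℝ X]
    (e : UnconditionalSchauderBasis ι ℝ X) : Prop :=
  ∀ (σ : Finset ι) (x : X), ‖e.proj σ x‖ ≤ ‖x‖

/-- `inf { sup { ‖P_σ x‖ : σ ⊆ ι, |σ| = n } : x ∈ S }`, computed in `[0, ∞]`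
(so that no bound or non-emptiness has to be known in advance). -/
noncomputable def projConstant {X ι : Type*} [NormedAddCommGroup X] [NormedSpace ℝ X]
    (e : UnconditionalSchauderBasis ι ℝ X) (S : Set X) (n : ℕ) : ℝ≥0∞ :=
  ⨅ x ∈ S, ⨆ (σ : Finset ι) (_ : σ.card = n), ‖e.proj σ x‖ₑ

/-- A seminorm `p` on `X` is an equivalent norm if `a ‖x‖ ≤ p x ≤ b ‖x‖` for some `a, b > 0`
(the lower bound makes `p` definite). -/
def IsEquivalentNorm {X : Type*} [NormedAddCommGroup X] [NormedSpace ℝ X]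
    (p : Seminorm ℝ X) : Prop :=
  ∃ a b : ℝ, 0 < a ∧ 0 < b ∧ ∀ x : X, a * ‖x‖ ≤ p x ∧ p x ≤ b * ‖x‖

/-- `p` is `C^∞` smooth: it has continuous Fréchet derivatives of all orders on `X \ {0}`. -/
def IsSmoothNorm {X : Type*} [NormedAddCommGroup X] [NormedSpace ℝ X]
    (p : Seminorm ℝ X) : Prop :=
  ContDiffOn ℝ ∞ (fun x : X => p x) {x : X | x ≠ 0}

/-! The new norm is the gauge of a convex body `B` cut out by smooth convex functions, locally
finitely many of which are nonzero near each point of `B`. Choose thresholds `r n < s n < t n < r (n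
+ 1)` increasing to 1, with `t n` below (a truncation of) `c_n`. For each finite `σ`, finitely many
functionals `g` nearly norm the span of `e '' σ`, and a ramp applied to `g (P_σ x)` vanishes if
`‖P_σ x‖ ≤ r |σ|`, while some ramp exceeds 1 if `‖P_σ x‖ > t |σ|`. `B` is the set where all finite
sums of ramps are at most 1.

On `B`, `‖P_σ x‖ ≤ t |σ|` for all `σ`, so the hypothesis on `c_n` forces `‖x‖ < 1`
(`exists_lt_norm_proj`). The gap `t n < r (n + 1)` gives local finiteness
(`eventually_norm_proj_le`), and the implicit function theorem makes the gauge smooth. -/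

theorem exists_smooth_convex_ramp {r s : ℝ} (hrs : r < s) :
    ∃ η : ℝ → ℝ, ContDiff ℝ ∞ η ∧ ConvexOn ℝ Set.univ η ∧ (∀ t, 0 ≤ η t) ∧ (∀ t, η (-t) = η t) ∧
      (∀ t, |t| ≤ r → η t = 0) ∧ ∀ t, s ≤ |t| → 1 < η t := by
  set ψ : ℝ → ℝ := fun t => ∫ x in (0 : ℝ)..t, expNegInvGlue x with hψ
  have hcont : Continuous expNegInvGlue := (expNegInvGlue.contDiff (n := 0)).continuous
  have hder : ∀ t, HasDerivAt ψ (expNegInvGlue t) t := fun t =>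
    hcont.integral_hasStrictDerivAt 0 t |>.hasDerivAt
  have hderiv : deriv ψ = expNegInvGlue := funext fun t => (hder t).deriv
  have hdiff : Differentiable ℝ ψ := fun t => (hder t).differentiableAt
  have hsmooth : ContDiff ℝ ∞ ψ := by
    rw [contDiff_infty_iff_deriv, hderiv]
    exact ⟨hdiff, expNegInvGlue.contDiff⟩
  have hconv : ConvexOn ℝ Set.univ ψ :=
    Monotone.convexOn_univ_of_deriv hdiff (hderiv ▸ expNegInvGlue.monotone)
  have hmono : Monotone ψ := monotone_of_deriv_nonneg hdiff fun t => by
    rw [hderiv]; exact expNegInvGlue.nonneg t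
  have hzero : ∀ t ≤ 0, ψ t = 0 := fun t ht => by
    rw [hψ]
    refine intervalIntegral.integral_zero_ae (Eventually.of_forall fun x hx => ?_)
    rw [Set.uIoc_of_ge ht] at hx
    exact expNegInvGlue.zero_of_nonpos hx.2
  have hnonneg : ∀ t, 0 ≤ ψ t := fun t => by
    rcases le_total t 0 with h | h
    · exact (hzero t h).ge
    · exact (hzero 0 le_rfl) ▸ hmono h
  have hpos : 0 < ψ (s - r) :=
    intervalIntegral.intervalIntegral_pos_of_pos_on (hcont.intervalIntegrable _ _)
      (fun x hx => expNegInvGlue.pos_of_pos hx.1) (sub_pos.2 hrs)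
  have hconv₁ : ConvexOn ℝ Set.univ fun t => ψ (-r + t) := by
    simpa [Function.comp_def] using hconv.translate_right (-r)
  have hconv₂ : ConvexOn ℝ Set.univ fun t => ψ (-r + -t) := by
    simpa [Function.comp_def] using hconv₁.comp_linearMap (-LinearMap.id)
  have hc : 0 < 2 / ψ (s - r) := div_pos two_pos hpos
  refine ⟨fun t => 2 / ψ (s - r) * (ψ (-r + t) + ψ (-r + -t)), ?_, ?_, ?_, ?_, ?_, ?_⟩
  · fun_prop
  · exact (hconv₁.add hconv₂).smul hc.le
  · exact fun t => mul_nonneg hc.le (add_nonneg (hnonneg _) (hnonneg _))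
  · intro t
    simp [add_comm]
  · intro t ht
    obtain ⟨h₁, h₂⟩ := abs_le.1 ht
    simp only
    rw [hzero (-r + t) (by linarith), hzero (-r + -t) (by linarith)]
    simp
  · intro t ht
    have key : ψ (s - r) ≤ ψ (-r + t) + ψ (-r + -t) := by
      rcases le_abs.1 ht with h | h
      · linarith [hmono (show s - r ≤ -r + t by linarith), hnonneg (-r + -t)]
      · linarith [hmono (show s - r ≤ -r + -t by linarith), hnonneg (-r + t)]
    calc (1 : ℝ) < 2 := one_lt_two
      _ = 2 / ψ (s - r) * ψ (s - r) := (div_mul_cancel₀ _ hpos.ne').symm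
      _ ≤ _ := mul_le_mul_of_nonneg_left key hc.le

/-- Compactness of the unit sphere of `E` reduces its Hahn–Banach norming functionals to finitely
many, at the cost of the factor `θ`. -/
theorem Submodule.exists_finset_norming {X : Type*} [NormedAddCommGroup X] [NormedSpace ℝ X]
    (E : Submodule ℝ X) [FiniteDimensional ℝ E] {θ : ℝ} (hθ : θ < 1) :
    ∃ A : Finset (StrongDual ℝ X), (∀ g ∈ A, ‖g‖ ≤ 1) ∧
      ∀ w ∈ E, w ≠ 0 → ∃ g ∈ A, θ * ‖w‖ < g w := by
  classical
  have hK : IsCompact (Metric.sphere (0 : E) 1) := isCompact_sphere _ _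
  choose! g hg₁ hg₂ using fun (v : E) (hv : v ≠ 0) =>
    exists_dual_vector ℝ (v : X) (by simpa using hv)
  obtain ⟨T, hT, hcover⟩ := hK.elim_nhds_subcover (fun v => {w : E | θ < g v w}) fun v hv => by
    have hv0 : v ≠ 0 := by rintro rfl; simp at hv
    have hv1 : ‖(v : X)‖ = 1 := by simpa using hv
    refine ((g v).continuous.comp continuous_subtype_val).continuousAt.eventually_const_lt ?_
    simpa [hg₂ v hv0, hv1] using hθ
  refine ⟨T.image g, ?_, fun w hw hw0 => ?_⟩
  · simp only [Finset.mem_image]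
    rintro _ ⟨v, hv, rfl⟩
    have hv0 : v ≠ 0 := by rintro rfl; simpa using hT 0 hv
    exact (hg₁ v hv0).le
  · have hpos : 0 < ‖w‖ := norm_pos_iff.2 hw0
    set w' : E := ‖w‖⁻¹ • ⟨w, hw⟩ with hw'
    have hmem : w' ∈ Metric.sphere (0 : E) 1 := by
      simp [hw', norm_smul, hpos.ne']
    obtain ⟨v, hv, hvw⟩ := Set.mem_iUnion₂.1 (hcover hmem)
    refine ⟨g v, Finset.mem_image_of_mem g hv, ?_⟩
    have : θ < ‖w‖⁻¹ * g v w := by simpa [hw'] using hvw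
    rwa [inv_mul_eq_div, lt_div_iff₀ hpos] at this

/-! ### Smooth gauges from locally finite families -/

/-- The set where all finite sums of a family of functions are at most one. -/
def sumSublevel {X I : Type*} (φ : I → X → ℝ) : Set X :=
  {x | ∀ F : Finset I, ∑ i ∈ F, φ i x ≤ 1}

section LocallyFinite

variable {X I : Type*} [NormedAddCommGroup X] [NormedSpace ℝ X] {φ : I → X → ℝ}

theorem convexOn_finset_sum (hconv : ∀ i, ConvexOn ℝ Set.univ (φ i)) (F : Finset I) :
    ConvexOn ℝ Set.univ fun x => ∑ i ∈ F, φ i x := by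
  refine ⟨convex_univ, fun x hx y hy a b ha hb hab => ?_⟩
  simp only [smul_eq_mul, Finset.mul_sum, ← Finset.sum_add_distrib]
  exact Finset.sum_le_sum fun i _ => (hconv i).2 hx hy ha hb hab

theorem convex_sumSublevel (hconv : ∀ i, ConvexOn ℝ Set.univ (φ i)) :
    Convex ℝ (sumSublevel φ) := by
  have : sumSublevel φ = ⋂ F : Finset I, {x | x ∈ Set.univ ∧ ∑ i ∈ F, φ i x ≤ 1} := by
    ext; simp [sumSublevel]
  rw [this]
  exact convex_iInter fun F => (convexOn_finset_sum hconv F).convex_le 1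

omit [NormedSpace ℝ X] in
theorem isClosed_sumSublevel (hcont : ∀ i, Continuous (φ i)) : IsClosed (sumSublevel φ) := by
  have : sumSublevel φ = ⋂ F : Finset I, {x | ∑ i ∈ F, φ i x ≤ 1} := by
    ext; simp [sumSublevel]
  rw [this]
  exact isClosed_iInter fun F => isClosed_le (by fun_prop) continuous_const

omit [NormedSpace ℝ X] in
theorem sumSublevel_mem_nhds (hcont : ∀ i, Continuous (φ i)) (hnonneg : ∀ i x, 0 ≤ φ i x)
    {x : X} {F : Finset I} (hF : ∀ᶠ y in 𝓝 x, ∀ i ∉ F, φ i y = 0) (hx : ∑ i ∈ F, φ i x < 1) :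
    sumSublevel φ ∈ 𝓝 x := by
  classical
  have hlt : ∀ᶠ y in 𝓝 x, ∑ i ∈ F, φ i y < 1 :=
    (continuous_finsetSum F fun i _ => hcont i).continuousAt.eventually_lt_const hx
  filter_upwards [hF, hlt] with y hy hy1 G
  calc ∑ i ∈ G, φ i y ≤ ∑ i ∈ G ∪ F, φ i y :=
        Finset.sum_le_sum_of_subset_of_nonneg Finset.subset_union_left fun i _ _ => hnonneg i y
    _ = ∑ i ∈ F, φ i y :=
        (Finset.sum_subset Finset.subset_union_right fun i _ hi => hy i hi).symm
    _ ≤ 1 := hy1.le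

/-- `(p y)⁻¹` solves `Φ (τ • y) = 1` for `τ`. Convexity bounds the radial derivative below by the
slope from `0`, which is `1 / T > 0`, so the implicit function theorem applies. -/
theorem contDiffAt_of_comp_inv_smul_eq_one [CompleteSpace X] {Φ : X → ℝ} {p : X → ℝ} {x : X}
    (hΦ : ContDiff ℝ ∞ Φ) (hconv : ConvexOn ℝ Set.univ Φ) (h0 : Φ 0 = 0)
    (hp : ContinuousAt p x) (hpx : 0 < p x) (heq : ∀ᶠ y in 𝓝 x, Φ ((p y)⁻¹ • y) = 1) :
    ContDiffAt ℝ ∞ p x := by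
  set f : X × ℝ → ℝ := fun v => Φ (v.2 • v.1) with hf
  set T : ℝ := (p x)⁻¹ with hT
  have hTpos : 0 < T := inv_pos.2 hpx
  have hfs : ContDiff ℝ ∞ f := hΦ.comp (contDiff_snd.smul contDiff_fst)
  have hfu : f (x, T) = 1 := heq.self_of_nhds
  have cdf : ContDiffAt ℝ ∞ f (x, T) := hfs.contDiffAt
  have hne : (∞ : WithTop ℕ∞) ≠ 0 := by simp
  have hpart : HasDerivAt (fun s : ℝ => f (x, s)) (fderiv ℝ f (x, T) (0, 1)) T := by
    have h₁ : HasFDerivAt f (fderiv ℝ f (x, T)) (x, T) :=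
      (hfs.differentiable hne).differentiableAt.hasFDerivAt
    exact h₁.comp_hasDerivAt T ((hasDerivAt_const T x).prodMk (hasDerivAt_id T))
  have hconv' : ConvexOn ℝ Set.univ fun s : ℝ => f (x, s) := by
    simpa [Function.comp_def, hf] using
      hconv.comp_linearMap (LinearMap.toSpanSingleton ℝ X x)
  have hderpos : 0 < fderiv ℝ f (x, T) (0, 1) := by
    have h := hconv'.slope_le_of_hasDerivAt (Set.mem_univ 0) (Set.mem_univ T) hTpos hpart
    refine lt_of_lt_of_le ?_ h
    simp [slope_def_field, hfu, hTpos]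
    simp [hf, h0]
  have if₂ : (fderiv ℝ f (x, T) ∘L .inr ℝ X ℝ).IsInvertible := by
    refine ⟨ContinuousLinearEquiv.unitsEquivAut ℝ (Units.mk0 _ hderpos.ne'), ?_⟩
    ext
    simp
  have hψ := cdf.contDiffAt_implicitFunction hne if₂
  have hinv : ContinuousAt (fun y => (p y)⁻¹) x := hp.inv₀ hpx.ne'
  have htend : Tendsto (fun y => (y, (p y)⁻¹)) (𝓝 x) (𝓝 (x, T)) :=
    (continuousAt_id.prodMk hinv)
  have hev : (fun y => (p y)⁻¹) =ᶠ[𝓝 x] cdf.implicitFunction hne if₂ := by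
    filter_upwards [htend.eventually (cdf.eventually_apply_eq_iff_implicitFunction hne if₂), heq]
      with y hy hy1
    exact (hy.1 (by rw [hfu]; exact hy1)).symm
  simpa only [inv_inv] using (hψ.congr_of_eventuallyEq hev).fun_inv (inv_ne_zero hpx.ne')

theorem exists_isEquivalentNorm_isSmoothNorm [CompleteSpace X]
    (hconv : ∀ i, ConvexOn ℝ Set.univ (φ i)) (hsmooth : ∀ i, ContDiff ℝ ∞ (φ i))
    (hnonneg : ∀ i x, 0 ≤ φ i x) (heven : ∀ i x, φ i (-x) = φ i x) (hzero : ∀ i, φ i 0 = 0)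
    (hbdd : Bornology.IsBounded (sumSublevel φ))
    (hloc : ∀ x ∈ sumSublevel φ, ∃ F : Finset I, ∀ᶠ y in 𝓝 x, ∀ i ∉ F, φ i y = 0) :
    ∃ p : Seminorm ℝ X, IsEquivalentNorm p ∧ IsSmoothNorm p := by
  set B := sumSublevel φ with hB
  have hcont : ∀ i, Continuous (φ i) := fun i => (hsmooth i).continuous
  have hBconv : Convex ℝ B := convex_sumSublevel hconv
  have h0B : (0 : X) ∈ B := fun F => by simp [hzero]
  have hB0 : B ∈ 𝓝 (0 : X) := by
    obtain ⟨F, hF⟩ := hloc 0 h0B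
    exact sumSublevel_mem_nhds hcont hnonneg hF (by simp [hzero])
  have hneg : ∀ x ∈ B, -x ∈ B := fun x hx F => by simpa [heven] using hx F
  have hbal : Balanced ℝ B := by
    rw [balanced_iff_neg_mem hBconv]
    exact fun x hx => hneg x hx
  have habs : Absorbent ℝ B := absorbent_nhds_zero hB0
  have hgc : Continuous (gauge B) := continuous_gauge hBconv hB0
  obtain ⟨ρ, hρ, hρB⟩ := Metric.mem_nhds_iff.1 hB0
  obtain ⟨R, hR, hBR⟩ := hbdd.subset_closedBall_lt 0 0
  have hlower : ∀ x, ‖x‖ / R ≤ gauge B x := fun x => le_gauge_of_subset_closedBall habs hR.le hBR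
  refine ⟨gaugeSeminorm hbal hBconv habs, ⟨R⁻¹, ρ⁻¹, inv_pos.2 hR, inv_pos.2 hρ, fun x => ⟨?_, ?_⟩⟩,
    ?_⟩
  · rw [inv_mul_eq_div]
    exact hlower x
  · rw [inv_mul_eq_div, le_div_iff₀ hρ, mul_comm]
    exact mul_gauge_le_norm hρB
  · intro x hx
    refine ContDiffAt.contDiffWithinAt ?_
    change ContDiffAt ℝ ∞ (gauge B) x
    have hpos : ∀ y : X, y ≠ 0 → 0 < gauge B y := fun y hy =>
      (div_pos (norm_pos_iff.2 hy) hR).trans_le (hlower y)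
    have hunit : ∀ y : X, y ≠ 0 → gauge B ((gauge B y)⁻¹ • y) = 1 := fun y hy => by
      rw [gauge_smul_of_nonneg (inv_nonneg.2 (gauge_nonneg y)), smul_eq_mul,
        inv_mul_cancel₀ (hpos y hy).ne']
    have hmem : ∀ y, gauge B y = 1 → y ∈ B := fun y hy => by
      have := (gauge_le_one_iff_mem_closure hBconv hB0).1 hy.le
      rwa [(isClosed_sumSublevel hcont).closure_eq] at this
    have hx0 := hpos x hx
    obtain ⟨F, hF⟩ := hloc _ (hmem _ (hunit x hx))
    -- A sum below 1 would, by local finiteness, make `y` an interior point, where the gauge is less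
    -- than 1.
    have hsum : ∀ y, gauge B y = 1 → (∀ᶠ z in 𝓝 y, ∀ i ∉ F, φ i z = 0) →
        ∑ i ∈ F, φ i y = 1 := fun y hy hyF => by
      refine (hmem y hy F).antisymm (not_lt.1 fun hlt => ?_)
      have := (gauge_lt_one_iff_mem_interior hBconv hB0).2
        (mem_interior_iff_mem_nhds.2 (sumSublevel_mem_nhds hcont hnonneg hyF hlt))
      exact this.ne hy
    refine contDiffAt_of_comp_inv_smul_eq_one (Φ := fun y => ∑ i ∈ F, φ i y)
      (ContDiff.sum fun i _ => hsmooth i) (convexOn_finset_sum hconv F) (by simp [hzero])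
      hgc.continuousAt hx0 ?_
    have htend : ContinuousAt (fun y => (gauge B y)⁻¹ • y) x :=
      (hgc.continuousAt.inv₀ hx0.ne').smul continuousAt_id
    filter_upwards [htend.eventually hF.eventually_nhds, isOpen_ne.mem_nhds hx] with y hy hy0
    exact hsum _ (hunit y hy0) hy

end LocallyFinite

/-! ### Choice of thresholds -/

theorem exists_strictMono_le {d : ℕ → ℝ} (hpos : ∀ n, 0 < d n) (hlim : Tendsto d atTop (𝓝 1)) :
    ∃ u : ℕ → ℝ, StrictMono u ∧ 0 < u 0 ∧ (∀ a < 1, ∃ n, a < u n) ∧ ∀ n, u (n + 1) ≤ d n := by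
  have hbdd : ∃ δ > 0, ∀ n, δ ≤ d n := by
    obtain ⟨M, hM⟩ := (hlim.inv₀ one_ne_zero).bddAbove_range
    have hMn : ∀ n, (d n)⁻¹ ≤ M := fun n => hM ⟨n, rfl⟩
    have hM0 : 0 < M := (inv_pos.2 (hpos 0)).trans_le (hMn 0)
    exact ⟨M⁻¹, inv_pos.2 hM0, fun n => (inv_le_comm₀ (hpos n) hM0).1 (hMn n)⟩
  obtain ⟨δ, hδ, hδd⟩ := hbdd
  have hbelow : ∀ n, BddBelow (Set.range fun m => d (n - 1 + m)) := fun n =>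
    ⟨δ, by rintro _ ⟨m, rfl⟩; exact hδd _⟩
  -- Tail infima are monotone but perhaps not strictly; the factor `1 - 1 / (n + 2)` below adds
  -- strictness. The shift by one yields `u (n + 1) ≤ d n`.
  set b : ℕ → ℝ := fun n => ⨅ m, d (n - 1 + m) with hb
  have hbpos : ∀ n, 0 < b n := fun n => hδ.trans_le (le_ciInf fun m => hδd _)
  have hbmono : Monotone b := fun n n' h => le_ciInf fun m => by
    have := ciInf_le (hbelow n) (n' - 1 - (n - 1) + m)
    rwa [show n - 1 + (n' - 1 - (n - 1) + m) = n' - 1 + m by omega] at this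
  have hw : ∀ n : ℕ, (0 : ℝ) < 1 - 1 / ((n : ℝ) + 2) := fun n => by
    rw [sub_pos, div_lt_one (by positivity)]
    linarith [(Nat.cast_nonneg n : (0 : ℝ) ≤ n)]
  refine ⟨fun n => (1 - 1 / ((n : ℝ) + 2)) * b n, strictMono_nat_of_lt_succ fun n => ?_,
    mul_pos (hw 0) (hbpos 0), fun a ha => ?_, fun n => ?_⟩
  · have h₁ : 1 / (((n + 1 : ℕ) : ℝ) + 2) < 1 / ((n : ℝ) + 2) :=
      one_div_lt_one_div_of_lt (by positivity) (by push_cast; linarith)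
    exact mul_lt_mul (by linarith) (hbmono n.le_succ) (hbpos n) (hw _).le
  · have hblim : Tendsto b atTop (𝓝 1) := by
      refine tendsto_order.2 ⟨fun c hc => ?_, fun c hc => ?_⟩
      · obtain ⟨c', hcc', hc'⟩ := exists_between hc
        obtain ⟨N, hN⟩ := eventually_atTop.1 (hlim.eventually_const_lt hc')
        filter_upwards [eventually_ge_atTop (N + 1)] with n hn
        exact hcc'.trans_le (le_ciInf fun m => (hN _ (by omega)).le)
      · filter_upwards [(tendsto_sub_atTop_nat 1).eventually (hlim.eventually_lt_const hc)] with n hn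
        exact (ciInf_le (hbelow n) 0).trans_lt hn
    have hwlim : Tendsto (fun n : ℕ => 1 - 1 / ((n : ℝ) + 2)) atTop (𝓝 1) := by
      have : Tendsto (fun n : ℕ => 1 / ((n : ℝ) + 2)) atTop (𝓝 0) :=
        tendsto_const_nhds.div_atTop
          (tendsto_atTop_add_const_right _ _ tendsto_natCast_atTop_atTop)
      simpa using this.const_sub 1
    exact (((hwlim.mul hblim).eventually_const_lt (by simpa using ha))).exists
  · have h₁ : b (n + 1) ≤ d n := by simpa [hb] using ciInf_le (hbelow (n + 1)) 0
    refine (mul_le_of_le_one_left (hbpos _).le ?_).trans h₁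
    have : (0 : ℝ) ≤ 1 / (((n + 1 : ℕ) : ℝ) + 2) := by positivity
    linarith

theorem exists_tendsto_one_ofReal_le {c : ℕ → ℝ≥0∞} (hpos : ∀ n ≥ 1, 0 < c n)
    (hlim : Tendsto c atTop (𝓝 1)) :
    ∃ d : ℕ → ℝ, (∀ n, 0 < d n) ∧ Tendsto d atTop (𝓝 1) ∧ ∀ n ≥ 1, ENNReal.ofReal (d n) ≤ c n := by
  refine ⟨fun n => if n = 0 then 1 else (min 1 (c n)).toReal, fun n => ?_, ?_, fun n hn => ?_⟩
  · dsimp only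
    split_ifs with h
    · exact one_pos
    · exact ENNReal.toReal_pos (lt_min one_pos (hpos n (Nat.one_le_iff_ne_zero.2 h))).ne'
        (min_lt_of_left_lt ENNReal.one_lt_top).ne
  · have h₁ : Tendsto (fun n => (min 1 (c n)).toReal) atTop (𝓝 1) := by
      have h : Tendsto (fun n => min 1 (c n)) atTop (𝓝 1) := by
        simpa using (tendsto_const_nhds (x := (1 : ℝ≥0∞))).min hlim
      simpa [Function.comp_def] using (ENNReal.tendsto_toReal ENNReal.one_ne_top).comp h
    refine h₁.congr' ?_
    filter_upwards [eventually_ge_atTop 1] with n hn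
    rw [if_neg (by omega)]
  · dsimp only
    rw [if_neg (by omega), ENNReal.ofReal_toReal (min_lt_of_left_lt ENNReal.one_lt_top).ne]
    exact min_le_right _ _

/-! ### Projection estimates -/

theorem exists_lt_norm_proj {X ι : Type*} [NormedAddCommGroup X] [NormedSpace ℝ X]
    (e : UnconditionalSchauderBasis ι ℝ X) {S : ℕ → Set X}
    (hS : Metric.sphere (0 : X) 1 = ⋃ n ≥ 1, S n) {d : ℕ → ℝ} (hd : ∀ n, 0 < d n)
    (hdS : ∀ n ≥ 1, ENNReal.ofReal (d n) ≤ projConstant e (S n) n) {t : ℕ → ℝ}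
    (ht : ∀ n, t n < d n) {x : X} (hx : x ≠ 0) :
    ∃ σ : Finset ι, t σ.card * ‖x‖ < ‖e.proj σ x‖ := by
  have hpos : 0 < ‖x‖ := norm_pos_iff.2 hx
  have hmem : ‖x‖⁻¹ • x ∈ Metric.sphere (0 : X) 1 := by
    simp [norm_smul, hpos.ne']
  rw [hS] at hmem
  simp only [Set.mem_iUnion] at hmem
  obtain ⟨n, hn, hxn⟩ := hmem
  have hlt : ENNReal.ofReal (t n) <
      ⨆ (σ : Finset ι) (_ : σ.card = n), ‖e.proj σ (‖x‖⁻¹ • x)‖ₑ :=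
    calc ENNReal.ofReal (t n) < ENNReal.ofReal (d n) :=
          (ENNReal.ofReal_lt_ofReal_iff (hd n)).2 (ht n)
      _ ≤ projConstant e (S n) n := hdS n hn
      _ ≤ _ := iInf₂_le _ hxn
  obtain ⟨σ, hσ⟩ := lt_iSup_iff.1 hlt
  obtain ⟨rfl, hσ⟩ := lt_iSup_iff.1 hσ
  refine ⟨σ, ?_⟩
  rw [← ofReal_norm] at hσ
  have h := lt_of_not_ge fun h => hσ.not_ge (ENNReal.ofReal_le_ofReal h)
  rw [map_smul, norm_smul, norm_inv, norm_norm, inv_mul_eq_div, lt_div_iff₀ hpos] at h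
  exact h

theorem eventually_norm_proj_le {X ι : Type*} [NormedAddCommGroup X] [NormedSpace ℝ X]
    (e : UnconditionalSchauderBasis ι ℝ X) (he : IsMonotoneBasis e) {r t : ℕ → ℝ}
    (hr : Monotone r) (htr : ∀ n, t n < r (n + 1)) {x : X}
    (hx : ∀ σ, ‖e.proj σ x‖ ≤ t σ.card) (hxr : ∃ n, ‖x‖ < r n) :
    ∃ F : Finset ι, ∀ᶠ y in 𝓝 x, ∀ σ : Finset ι, ¬ σ ⊆ F → ‖e.proj σ y‖ ≤ r σ.card := by
  classical
  obtain ⟨N, hN⟩ := hxr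
  have hε : ∀ᶠ ε : ℝ in 𝓝[>] 0, ‖x‖ + ε < r N ∧ ∀ m ∈ Finset.range N, t m + 2 * ε < r (m + 1) := by
    refine nhdsWithin_le_nhds (Filter.Eventually.and ?_ ?_)
    · refine (Continuous.tendsto (f := fun ε : ℝ => ‖x‖ + ε) (by fun_prop)
        0).eventually_lt_const ?_
      simpa using hN
    · refine (Finset.eventually_all _).2 fun m _ => ?_
      refine (Continuous.tendsto (f := fun ε : ℝ => t m + 2 * ε) (by fun_prop)
        0).eventually_lt_const ?_
      simpa using htr m
  obtain ⟨ε, ⟨hεN, hεm⟩, hε0⟩ := (hε.and self_mem_nhdsWithin).exists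
  obtain ⟨F, hF⟩ := ((e.tendsto_proj x).eventually (Metric.ball_mem_nhds x hε0)).exists
  rw [dist_comm, dist_eq_norm] at hF
  refine ⟨F, ?_⟩
  filter_upwards [Metric.ball_mem_nhds x hε0] with y hy σ hσ
  rw [Metric.mem_ball, dist_eq_norm] at hy
  rcases le_or_gt N σ.card with h | h
  · calc ‖e.proj σ y‖ ≤ ‖y‖ := he σ y
      _ ≤ ‖x‖ + ‖y - x‖ := norm_le_norm_add_norm_sub' y x
      _ ≤ r N := by linarith
      _ ≤ r σ.card := hr h
  -- Since `σ` leaves `F`, `σ ∩ F` is smaller by at least one index; the gap between `t m` and `r (m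
  -- + 1)` absorbs both `ε` errors.
  · have hcard : (σ ∩ F).card < σ.card := Finset.card_lt_card
      (Finset.inter_subset_left.ssubset_of_ne fun h => hσ (Finset.inter_eq_left.1 h))
    have hsplit : e.proj σ y =
        e.proj (σ ∩ F) x + e.proj σ (x - e.proj F x) + e.proj σ (y - x) := by
      rw [map_sub, map_sub, e.proj_comp]
      abel
    have hm := hεm (σ ∩ F).card (Finset.mem_range.2 (hcard.trans h))
    calc ‖e.proj σ y‖ ≤ ‖e.proj (σ ∩ F) x‖ + ‖e.proj σ (x - e.proj F x)‖ + ‖e.proj σ (y - x)‖ := by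
          rw [hsplit]; exact norm_add₃_le
      _ ≤ t (σ ∩ F).card + ‖x - e.proj F x‖ + ‖y - x‖ :=
          add_le_add (add_le_add (hx _) (he _ _)) (he _ _)
      _ ≤ r ((σ ∩ F).card + 1) := by linarith
      _ ≤ r σ.card := hr hcard

/-! ### Assembly -/

theorem mainTheorem3 {X ι : Type*} [NormedAddCommGroup X] [NormedSpace ℝ X] [CompleteSpace X]
    (e : UnconditionalSchauderBasis ι ℝ X) (he : IsMonotoneBasis e)
    (S : ℕ → Set X) (hS : Metric.sphere (0 : X) 1 = ⋃ n ≥ 1, S n)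
    (hpos : ∀ n ≥ 1, 0 < projConstant e (S n) n)
    (hlim : Tendsto (fun n => projConstant e (S n) n) atTop (𝓝 1)) :
    ∃ p : Seminorm ℝ X, IsEquivalentNorm p ∧ IsSmoothNorm p := by
  classical
  obtain ⟨d, hd, hd1, hdS⟩ := exists_tendsto_one_ofReal_le hpos hlim
  obtain ⟨u, hu, hu0, hu1, hud⟩ := exists_strictMono_le hd hd1
  have hstep : ∀ n, u n < u (n + 1) := fun n => hu n.lt_succ_self
  obtain ⟨r, hur, hr⟩ : ∃ r : ℕ → ℝ, (∀ n, u n < r n) ∧ ∀ n, r n < u (n + 1) := by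
    choose r hr using fun n => exists_between (hstep n)
    exact ⟨r, fun n => (hr n).1, fun n => (hr n).2⟩
  choose s hrs hsu using fun n => exists_between (hr n)
  choose t hst htu using fun n => exists_between (hsu n)
  have hr0 : ∀ n, 0 < r n := fun n => (hu0.trans_le (hu.monotone n.zero_le)).trans (hur n)
  have hs0 : ∀ n, 0 < s n := fun n => (hr0 n).trans (hrs n)
  have ht0 : ∀ n, 0 < t n := fun n => (hs0 n).trans (hst n)
  have hrmono : StrictMono r := strictMono_nat_of_lt_succ fun n => (hr n).trans (hur (n + 1))
  choose η hηsmooth hηconv hηnonneg hηeven hηzero hηone using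
    fun n => exists_smooth_convex_ramp (hrs n)
  have hfin : ∀ σ : Finset ι, FiniteDimensional ℝ (Submodule.span ℝ (e '' σ)) := fun σ =>
    FiniteDimensional.span_of_finite ℝ (σ.finite_toSet.image e)
  -- The ratio `s / t` turns `‖P_σ x‖ > t |σ|` into `g (P_σ x) > s |σ|`, where the ramp exceeds 1.
  choose A hA₁ hA₂ using fun σ : Finset ι =>
    (Submodule.span ℝ (e '' σ)).exists_finset_norming
      ((div_lt_one (ht0 σ.card)).2 (hst σ.card))
  have hrange : ∀ (σ : Finset ι) (x : X), e.proj σ x ∈ Submodule.span ℝ (e '' σ) := fun σ x => by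
    rw [← e.range_proj_eq_span]
    exact ⟨x, rfl⟩
  set φ : (Σ σ : Finset ι, A σ) → X → ℝ := fun i x => η i.1.card (i.2.1 (e.proj i.1 x)) with hφ
  have hφzero : ∀ i x, ‖e.proj i.1 x‖ ≤ r i.1.card → φ i x = 0 := fun i x hx => by
    refine hηzero _ _ (le_trans ?_ hx)
    rw [← Real.norm_eq_abs]
    exact (i.2.1.le_of_opNorm_le (hA₁ i.1 i.2.1 i.2.2) _).trans_eq (one_mul _)
  have hproj : ∀ x ∈ sumSublevel φ, ∀ σ, ‖e.proj σ x‖ ≤ t σ.card := fun x hx σ => by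
    by_contra! hlt
    have hne : e.proj σ x ≠ 0 := norm_pos_iff.1 ((ht0 _).trans hlt)
    obtain ⟨g, hg, hgx⟩ := hA₂ σ _ (hrange σ x) hne
    have h₁ : s σ.card ≤ g (e.proj σ x) := by
      refine le_trans ?_ hgx.le
      rw [div_mul_eq_mul_div, le_div_iff₀ (ht0 _)]
      exact mul_le_mul_of_nonneg_left hlt.le (hs0 _).le
    have h₂ := hx {⟨σ, g, hg⟩}
    rw [Finset.sum_singleton] at h₂
    exact (hηone σ.card _ (h₁.trans (le_abs_self _))).not_ge h₂
  have hnorm : ∀ x ∈ sumSublevel φ, ‖x‖ < 1 := fun x hx => by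
    rcases eq_or_ne x 0 with rfl | hx0
    · simp
    · obtain ⟨σ, hσ⟩ := exists_lt_norm_proj e hS hd hdS (fun n => (htu n).trans_le (hud n)) hx0
      have := hσ.trans_le (hproj x hx σ)
      exact (mul_lt_iff_lt_one_right (ht0 _)).1 this
  refine exists_isEquivalentNorm_isSmoothNorm (φ := φ) (fun i => ?_) (fun i => ?_)
    (fun i x => hηnonneg _ _) (fun i x => ?_) (fun i => ?_) ?_ fun x hx => ?_
  · exact (hηconv i.1.card).comp_linearMap (i.2.1 ∘L e.proj i.1).toLinearMap
  · exact (hηsmooth i.1.card).comp (i.2.1 ∘L e.proj i.1).contDiff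
  · simp only [hφ, map_neg, hηeven]
  · exact hφzero i 0 (by simpa using (hr0 _).le)
  · exact Metric.isBounded_ball.subset fun x hx => mem_ball_zero_iff.2 (hnorm x hx)
  · obtain ⟨F, hF⟩ := eventually_norm_proj_le e he hrmono.monotone
      (fun n => (htu n).trans (hur (n + 1))) (hproj x hx)
      ((hu1 _ (hnorm x hx)).imp fun n hn => hn.trans (hur n))
    -- Only subsets of `F` contribute near `x`, each with finitely many functionals.
    refine ⟨F.powerset.sigma fun σ => Finset.univ, ?_⟩
    filter_upwards [hF] with y hy i hi
    exact hφzero i y (hy i.1 (by simpa using hi))
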